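/- Consider the following simply typed calculus. Types are $T ::= \mathsf B \mid (T_1,\dots,T_n) \mid T\to T \mid T+T$ with $n\ge 1$. The derivative type $\frac{\partial T}{\partial S}$ is defined when $S$ is built from $\mathsf B$ by tuples: $\frac{\partial T}{\partial(S_1,\dots,S_n)}=(\frac{\partial T}{\partial S_1},\dots,\frac{\partial T}{\partial S_n})$, $\frac{\partial\mathsf B}{\partial\mathsf B}=\mathsf B$, and $\frac{\partial}{\partial\mathsf B}$ acts componentwise on tuples and sums and on the codomain of function types. Terms are constants $c$ (among them $0$), variables, $\lambda x{:}T.\,t$, $t\,t$, $(t_1,\dots,t_n)$, $\pi_j(t)$, $\mathrm{inl}\,t$, $\mathrm{inr}\,t$, $\mathrm{case}\ t\ \mathrm{of}\ \mathrm{inl}\,x_1\Rightarrow t_1\mid \mathrm{inr}\,x_2\Rightarrow t_2$, $t\oplus t$, $t\ominus t$, $t*t$, $\frac{\partial t}{\partial x}\big|_{t}$, $\int_{t}^{t}t\,dx$ and $\mathrm{fix}\,t$. The typing rules are the usual ones for the simply typed $\lambda$-calculus with constants of type $\mathsf B$, tuples and sums, together with: $t\oplus s, t\ominus s:T$ if $t,s:T$;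 $t*s:T$ if $t:\frac{\partial T}{\partial S}$ and $s:S$; $\frac{\partial t}{\partial x}\big|_s:\frac{\partial T}{\partial S}$ if $s:S$ and $t:T$ for $x:S$; $\int_a^b t\,dx:T$ if $a,b:S$ and $t:\frac{\partial T}{\partial S}$ for $x:S$; $\mathrm{fix}\,f:A$ if $f:A\to A$. One-step reduction $\to$ is the closure under all term constructors (also under binders) of the rules $(\lambda x{:}T.t)s\to t[s/x]$; $\pi_j(t_1,\dots,t_n)\to t_j$; $\mathrm{case}\ \mathrm{inl}\,s\ \mathrm{of}\ \mathrm{inl}\,x_1\Rightarrow t_1\mid \mathrm{inr}\,x_2\Rightarrow t_2\ \to\ t_1[s/x_1]$, and likewise for $\mathrm{inr}$; $\mathrm{fix}\,f\to f(\mathrm{fix}\,f)$; $(t_i)_i\odot(s_i)_i\to(t_i\odot s_i)_i$ and $(\lambda x{:}T.t)\odot(\lambda y{:}T.s)\to\lambda x{:}T.\,t\odot s[x/y]$ for $\odot\in\{\oplus,\ominus\}$; if $s:\mathsf B$, then $-*s$ and $\frac{\partial -}{\partial x}\big|_s$, and if $a,b:\mathsf B$, then $\int_a^b -\,dx$, are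 pushed inside a tuple, inside a $\lambda$-abstraction (avoiding capture), and inside $\mathrm{inl}$ and $\mathrm{inr}$; $(t_1,\dots,t_n)*(s_1,\dots,s_n)\to(t_1*s_1)\oplus\dots\oplus(t_n*s_n)$; $\frac{\partial t}{\partial x}\big|_{(s_1,\dots,s_n)}\to\Big(\frac{\partial\, t[(s_1,\dots,s_{j-1},x_j,s_{j+1},\dots,s_n)/x]}{\partial x_j}\Big|_{s_j}\Big)_{1\le j\le n}$; $\int_{(a_1,\dots,a_n)}^{(b_1,\dots,b_n)}t\,dx\to\bigoplus_{j=1}^n\int_{a_j}^{b_j}\pi_j\big(t[(b_1,\dots,b_{j-1},x_j,a_{j+1},\dots,a_n)/x]\big)dx_j$. A term is strongly normalisable if no infinite sequence of reductions starts from it. Reducibility of a (possibly open) term $t$ of type $T$ is defined by recursion on $T$: for $T=\mathsf B$, $t$ is reducible iff it is strongly normalisable; for $T=(T_1,\dots,T_n)$, iff every $\pi_j(t)$ is reducible; for $T=U\to V$, iff $t\,u$ is reducible for every reducible $u$ of type $U$ (where $u$ may have additional free variables); for $T=T_1+T_2$, iff $\mathrm{case}\ t\ \mathrm{of}\ \mathrm{inl}\,x_1\Rightarrow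 0\mid\mathrm{inr}\,x_2\Rightarrow 0$ is reducible of type $\mathsf B$. **Theorem.** Every well-typed term $t:T$ (in any typing context) that has no subterm of the form $\mathrm{fix}\,f$ is reducible of type $T$, and it is strongly normalisable. -/

import Mathlib

universe u

namespace DiffCalc

/-- Types: the base type, nonempty finite tuples, function types and binary sums. -/
inductive Ty : Type
  | base : Ty
  | tup {n : ℕ} (Ts : Fin (n + 1) → Ty) : Ty
  | arrow (A B : Ty) : Ty
  | sum (A B : Ty) : Ty

/-- `IsDeriv T S D` says that the derivative type `∂T/∂S` is defined and equal to `D`.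
It is defined exactly when `S` is built from the base type by tuples. -/
inductive IsDeriv : Ty → Ty → Ty → Prop
  | base : IsDeriv .base .base .base
  | tup {n : ℕ} {Ts Ds : Fin (n + 1) → Ty} :
      (∀ i, IsDeriv (Ts i) .base (Ds i)) → IsDeriv (.tup Ts) .base (.tup Ds)
  | arrow {A B D : Ty} : IsDeriv B .base D → IsDeriv (.arrow A B) .base (.arrow A D)
  | sum {A B D E : Ty} :
      IsDeriv A .base D → IsDeriv B .base E → IsDeriv (.sum A B) .base (.sum D E)
  | wrtTup {T : Ty} {n : ℕ} {Ss Ds : Fin (n + 1) → Ty} :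
      (∀ i, IsDeriv T (Ss i) (Ds i)) → IsDeriv T (.tup Ss) (.tup Ds)

/-- Terms over a set `C` of constants, up to renaming of bound variables (de Bruijn indices).
* `lam A t` is `λx:A. t`;
* `caseOf t a b` is `case t of inl x₁ ⇒ a | inr x₂ ⇒ b`;
* `deriv S t s` is `∂t/∂x|ₛ`, where the bound variable `x` has type `S`;
* `integ S a b t` is the integral of `t dx` from `a` to `b`, where `x` has type `S`;
* `mul S t s` is `t * s`, where `s` has type `S`.
In each case the bound variable is the variable `0` of the term in its scope. The type `S` recorded
in the last three forms serves to express the side conditions of the reduction rules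
that say that a subterm has the base type; the typing rules force it to be the right one. -/
inductive Term (C : Type u) : Type u
  | const (c : C) : Term C
  | var (k : ℕ) : Term C
  | lam (A : Ty) (t : Term C) : Term C
  | app (t s : Term C) : Term C
  | tup {n : ℕ} (ts : Fin (n + 1) → Term C) : Term C
  | proj {n : ℕ} (j : Fin (n + 1)) (t : Term C) : Term C
  | inl (t : Term C) : Term C
  | inr (t : Term C) : Term C
  | caseOf (t a b : Term C) : Term C
  | add (t s : Term C) : Term C
  | sub (t s : Term C) : Term C
  | mul (S : Ty) (t s : Term C) : Term C
  | deriv (S : Ty) (t s : Term C) : Term C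
  | integ (S : Ty) (a b t : Term C) : Term C
  | fixp (f : Term C) : Term C

namespace Term

variable {C : Type u}

/-- A renaming under one binder. -/
def liftRen (ρ : ℕ → ℕ) : ℕ → ℕ
  | 0 => 0
  | k + 1 => ρ k + 1

/-- Renaming of free variables. -/
def rename : (ℕ → ℕ) → Term C → Term C
  | _, const c => const c
  | ρ, var k => var (ρ k)
  | ρ, lam A t => lam A (rename (liftRen ρ) t)
  | ρ, app t s => app (rename ρ t) (rename ρ s)
  | ρ, tup ts => tup fun i => rename ρ (ts i)
  | ρ, proj j t => proj j (rename ρ t)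
  | ρ, inl t => inl (rename ρ t)
  | ρ, inr t => inr (rename ρ t)
  | ρ, caseOf t a b => caseOf (rename ρ t) (rename (liftRen ρ) a) (rename (liftRen ρ) b)
  | ρ, add t s => add (rename ρ t) (rename ρ s)
  | ρ, sub t s => sub (rename ρ t) (rename ρ s)
  | ρ, mul S t s => mul S (rename ρ t) (rename ρ s)
  | ρ, deriv S t s => deriv S (rename (liftRen ρ) t) (rename ρ s)
  | ρ, integ S a b t => integ S (rename ρ a) (rename ρ b) (rename (liftRen ρ) t)
  | ρ, fixp f => fixp (rename ρ f)

/-- Weakening by one fresh variable, which becomes the variable `0`. -/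
def shift (t : Term C) : Term C := rename Nat.succ t

/-- Exchange of the two innermost variables. -/
def swap (t : Term C) : Term C :=
  rename (fun k => if k = 0 then 1 else if k = 1 then 0 else k) t

/-- A substitution under one binder. -/
def liftSub (σ : ℕ → Term C) : ℕ → Term C
  | 0 => var 0
  | k + 1 => shift (σ k)

/-- Simultaneous capture-avoiding substitution. -/
def subst : (ℕ → Term C) → Term C → Term C
  | _, const c => const c
  | σ, var k => σ k
  | σ, lam A t => lam A (subst (liftSub σ) t)
  | σ, app t s => app (subst σ t) (subst σ s)
  | σ, tup ts => tup fun i => subst σ (ts i)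
  | σ, proj j t => proj j (subst σ t)
  | σ, inl t => inl (subst σ t)
  | σ, inr t => inr (subst σ t)
  | σ, caseOf t a b => caseOf (subst σ t) (subst (liftSub σ) a) (subst (liftSub σ) b)
  | σ, add t s => add (subst σ t) (subst σ s)
  | σ, sub t s => sub (subst σ t) (subst σ s)
  | σ, mul S t s => mul S (subst σ t) (subst σ s)
  | σ, deriv S t s => deriv S (subst (liftSub σ) t) (subst σ s)
  | σ, integ S a b t => integ S (subst σ a) (subst σ b) (subst (liftSub σ) t)
  | σ, fixp f => fixp (subst σ f)

/-- `t[s/x]`, where `x` is the variable `0` of `t`. -/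
def inst (t s : Term C) : Term C :=
  subst (fun k => match k with
    | 0 => s
    | k + 1 => var k) t

/-- `t[s/x]`, where `x` is the variable `0` of `t`, and where `s` lives in the scope of a new
variable `0` that takes the place of `x`. -/
def replace (t s : Term C) : Term C :=
  subst (fun k => match k with
    | 0 => s
    | k + 1 => var (k + 1)) t

/-- The tuple `(b₁, …, b_{j-1}, x_j, a_{j+1}, …, a_n)` with the new variable `x_j`, which is the
variable `0`. -/
def mixTup {n : ℕ} (a b : Fin (n + 1) → Term C) (j : Fin (n + 1)) : Term C :=
  tup fun i => if i < j then shift (b i) else if i = j then var 0 else shift (a i)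

/-- `t₁ ⊕ t₂ ⊕ ⋯ ⊕ t_{n+1}`, associated to the left. -/
def bigAdd : {n : ℕ} → (Fin (n + 1) → Term C) → Term C
  | 0, ts => ts 0
  | _ + 1, ts => add (bigAdd fun i => ts i.castSucc) (ts (Fin.last _))

/-- The term has no subterm of the form `fix f`. -/
def FixFree : Term C → Prop
  | const _ => True
  | var _ => True
  | lam _ t => FixFree t
  | app t s => FixFree t ∧ FixFree s
  | tup ts => ∀ i, FixFree (ts i)
  | proj _ t => FixFree t
  | inl t => FixFree t
  | inr t => FixFree t
  | caseOf t a b => FixFree t ∧ FixFree a ∧ FixFree b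
  | add t s => FixFree t ∧ FixFree s
  | sub t s => FixFree t ∧ FixFree s
  | mul _ t s => FixFree t ∧ FixFree s
  | deriv _ t s => FixFree t ∧ FixFree s
  | integ _ a b t => FixFree a ∧ FixFree b ∧ FixFree t
  | fixp _ => False

end Term

open Term

variable {C : Type u}

/-- The typing judgement `Γ ⊢ t : T`; the `k`-th entry of `Γ` is the type of the variable `k`. -/
inductive HasType : List Ty → Term C → Ty → Prop
  | const {Γ : List Ty} (c : C) : HasType Γ (const c) .base
  | var {Γ : List Ty} {k : ℕ} {T : Ty} : Γ[k]? = some T → HasType Γ (var k) T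
  | lam {Γ : List Ty} {A B : Ty} {t : Term C} :
      HasType (A :: Γ) t B → HasType Γ (lam A t) (.arrow A B)
  | app {Γ : List Ty} {A B : Ty} {t s : Term C} :
      HasType Γ t (.arrow A B) → HasType Γ s A → HasType Γ (app t s) B
  | tup {Γ : List Ty} {n : ℕ} {Ts : Fin (n + 1) → Ty} {ts : Fin (n + 1) → Term C} :
      (∀ i, HasType Γ (ts i) (Ts i)) → HasType Γ (tup ts) (.tup Ts)
  | proj {Γ : List Ty} {n : ℕ} {Ts : Fin (n + 1) → Ty} {t : Term C} (j : Fin (n + 1)) :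
      HasType Γ t (.tup Ts) → HasType Γ (proj j t) (Ts j)
  | inl {Γ : List Ty} {A B : Ty} {t : Term C} : HasType Γ t A → HasType Γ (inl t) (.sum A B)
  | inr {Γ : List Ty} {A B : Ty} {t : Term C} : HasType Γ t B → HasType Γ (inr t) (.sum A B)
  | caseOf {Γ : List Ty} {A B T : Ty} {t a b : Term C} :
      HasType Γ t (.sum A B) → HasType (A :: Γ) a T → HasType (B :: Γ) b T →
        HasType Γ (caseOf t a b) T
  | add {Γ : List Ty} {T : Ty} {t s : Term C} :
      HasType Γ t T → HasType Γ s T → HasType Γ (add t s) T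
  | sub {Γ : List Ty} {T : Ty} {t s : Term C} :
      HasType Γ t T → HasType Γ s T → HasType Γ (sub t s) T
  | mul {Γ : List Ty} {T S D : Ty} {t s : Term C} :
      IsDeriv T S D → HasType Γ t D → HasType Γ s S → HasType Γ (mul S t s) T
  | deriv {Γ : List Ty} {T S D : Ty} {t s : Term C} :
      IsDeriv T S D → HasType (S :: Γ) t T → HasType Γ s S → HasType Γ (deriv S t s) D
  | integ {Γ : List Ty} {T S D : Ty} {a b t : Term C} :
      IsDeriv T S D → HasType Γ a S → HasType Γ b S → HasType (S :: Γ) t D →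
        HasType Γ (integ S a b t) T
  | fixp {Γ : List Ty} {A : Ty} {f : Term C} :
      HasType Γ f (.arrow A A) → HasType Γ (fixp f) A

/-- One-step reduction, in an arbitrary position of the term. -/
inductive Step : Term C → Term C → Prop
  -- computation rules
  | beta {A : Ty} {t s : Term C} : Step (app (lam A t) s) (inst t s)
  | projTup {n : ℕ} {ts : Fin (n + 1) → Term C} {j : Fin (n + 1)} :
      Step (proj j (tup ts)) (ts j)
  | caseInl {t a b : Term C} : Step (caseOf (inl t) a b) (inst a t)
  | caseInr {t a b : Term C} : Step (caseOf (inr t) a b) (inst b t)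
  | fixUnfold {f : Term C} : Step (fixp f) (app f (fixp f))
  | addTup {n : ℕ} {ts ss : Fin (n + 1) → Term C} :
      Step (add (tup ts) (tup ss)) (tup fun i => add (ts i) (ss i))
  | addLam {A : Ty} {t s : Term C} : Step (add (lam A t) (lam A s)) (lam A (add t s))
  | subTup {n : ℕ} {ts ss : Fin (n + 1) → Term C} :
      Step (sub (tup ts) (tup ss)) (tup fun i => sub (ts i) (ss i))
  | subLam {A : Ty} {t s : Term C} : Step (sub (lam A t) (lam A s)) (lam A (sub t s))
  -- product with a factor of base type, and product of tuples
  | mulTup {n : ℕ} {ts : Fin (n + 1) → Term C} {s : Term C} :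
      Step (mul .base (tup ts) s) (tup fun i => mul .base (ts i) s)
  | mulLam {A : Ty} {t s : Term C} :
      Step (mul .base (lam A t) s) (lam A (mul .base t (shift s)))
  | mulInl {t s : Term C} : Step (mul .base (inl t) s) (inl (mul .base t s))
  | mulInr {t s : Term C} : Step (mul .base (inr t) s) (inr (mul .base t s))
  | mulTupTup {n : ℕ} {Ss : Fin (n + 1) → Ty} {ts ss : Fin (n + 1) → Term C} :
      Step (mul (.tup Ss) (tup ts) (tup ss)) (bigAdd fun j => mul (Ss j) (ts j) (ss j))
  -- derivative in a variable of base type, and of tuple type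
  | derivTup {n : ℕ} {ts : Fin (n + 1) → Term C} {s : Term C} :
      Step (deriv .base (tup ts) s) (tup fun i => deriv .base (ts i) s)
  | derivLam {A : Ty} {t s : Term C} :
      Step (deriv .base (lam A t) s) (lam A (deriv .base (swap t) (shift s)))
  | derivInl {t s : Term C} : Step (deriv .base (inl t) s) (inl (deriv .base t s))
  | derivInr {t s : Term C} : Step (deriv .base (inr t) s) (inr (deriv .base t s))
  | derivAtTup {n : ℕ} {Ss : Fin (n + 1) → Ty} {t : Term C} {ss : Fin (n + 1) → Term C} :
      Step (deriv (.tup Ss) t (tup ss))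
        (tup fun j => deriv (Ss j) (replace t (mixTup ss ss j)) (ss j))
  -- integral in a variable of base type, and of tuple type
  | integTup {n : ℕ} {a b : Term C} {ts : Fin (n + 1) → Term C} :
      Step (integ .base a b (tup ts)) (tup fun i => integ .base a b (ts i))
  | integLam {A : Ty} {a b t : Term C} :
      Step (integ .base a b (lam A t)) (lam A (integ .base (shift a) (shift b) (swap t)))
  | integInl {a b t : Term C} : Step (integ .base a b (inl t)) (inl (integ .base a b t))
  | integInr {a b t : Term C} : Step (integ .base a b (inr t)) (inr (integ .base a b t))
  | integAtTup {n : ℕ} {Ss : Fin (n + 1) → Ty} {as bs : Fin (n + 1) → Term C} {t : Term C} :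
      Step (integ (.tup Ss) (tup as) (tup bs) t)
        (bigAdd fun j => integ (Ss j) (as j) (bs j) (proj j (replace t (mixTup as bs j))))
  -- reduction inside a term
  | inLam {A : Ty} {t t' : Term C} : Step t t' → Step (lam A t) (lam A t')
  | inAppL {t t' s : Term C} : Step t t' → Step (app t s) (app t' s)
  | inAppR {t s s' : Term C} : Step s s' → Step (app t s) (app t s')
  | inTup {n : ℕ} {ts : Fin (n + 1) → Term C} {t' : Term C} (i : Fin (n + 1)) :
      Step (ts i) t' → Step (tup ts) (tup (Function.update ts i t'))
  | inProj {n : ℕ} {j : Fin (n + 1)} {t t' : Term C} : Step t t' → Step (proj j t) (proj j t')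
  | inInl {t t' : Term C} : Step t t' → Step (inl t) (inl t')
  | inInr {t t' : Term C} : Step t t' → Step (inr t) (inr t')
  | inCase {t t' a b : Term C} : Step t t' → Step (caseOf t a b) (caseOf t' a b)
  | inCaseL {t a a' b : Term C} : Step a a' → Step (caseOf t a b) (caseOf t a' b)
  | inCaseR {t a b b' : Term C} : Step b b' → Step (caseOf t a b) (caseOf t a b')
  | inAddL {t t' s : Term C} : Step t t' → Step (add t s) (add t' s)
  | inAddR {t s s' : Term C} : Step s s' → Step (add t s) (add t s')
  | inSubL {t t' s : Term C} : Step t t' → Step (sub t s) (sub t' s)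
  | inSubR {t s s' : Term C} : Step s s' → Step (sub t s) (sub t s')
  | inMulL {S : Ty} {t t' s : Term C} : Step t t' → Step (mul S t s) (mul S t' s)
  | inMulR {S : Ty} {t s s' : Term C} : Step s s' → Step (mul S t s) (mul S t s')
  | inDerivL {S : Ty} {t t' s : Term C} : Step t t' → Step (deriv S t s) (deriv S t' s)
  | inDerivR {S : Ty} {t s s' : Term C} : Step s s' → Step (deriv S t s) (deriv S t s')
  | inIntegL {S : Ty} {a a' b t : Term C} : Step a a' → Step (integ S a b t) (integ S a' b t)
  | inIntegR {S : Ty} {a b b' t : Term C} : Step b b' → Step (integ S a b t) (integ S a b' t)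
  | inInteg {S : Ty} {a b t t' : Term C} : Step t t' → Step (integ S a b t) (integ S a b t')
  | inFix {f f' : Term C} : Step f f' → Step (fixp f) (fixp f')

/-- Strong normalisability: there is no infinite reduction sequence from the term. -/
def SN (t : Term C) : Prop := Acc (fun t' t : Term C => Step t t') t

/-- `Red T Γ t`: the term `t`, of type `T` in the context `Γ`, is reducible. In a function type the
argument may contain further free variables, whose types are listed in `Δ`; appending `Δ` at
the end of the context leaves the indices of the variables of `t` unchanged. -/
def Red [Zero C] : Ty → List Ty → Term C → Prop
  | .base, Γ, t => HasType Γ t .base ∧ SN t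
  | .tup Ts, Γ, t => HasType Γ t (.tup Ts) ∧ ∀ j, Red (Ts j) Γ (proj j t)
  | .arrow A B, Γ, t => HasType Γ t (.arrow A B) ∧
      ∀ (Δ : List Ty) (s : Term C), Red A (Γ ++ Δ) s → Red B (Γ ++ Δ) (app t s)
  | .sum A B, Γ, t => HasType Γ t (.sum A B) ∧ SN (caseOf t (const 0) (const 0))

end DiffCalc

/-! Reducibility as defined says nothing about what an injection carries, so it is too weak to drive
an induction over terms. The stronger predicate `Good` does so: a term is good at T if it is
strongly normalising and every introduction form among its reducts (itself included) has the shape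
that T prescribes, with good components; for an abstraction, the body must be good at every good
argument. It is a predicate on raw terms, so no preservation of types under reduction is needed.

Every constructor except `fix` preserves `Good`. Elimination forms and operations are not
introductions, so by `Good.of_neutral` only their one-step reducts need checking, by induction on
the reductions of the immediate subterms. The operations ⊕, ⊖, and *, derivative and integral over
the base type, also need an outer induction on T, because their root rules move the operation into
the components. The last three are then extended to all tuple-built S by induction on S.
`HasType.good_subst` assembles these facts, and the identity substitution gives `HasType.sn`.

Reducibility is recovered in `red_iff`: on well-typed terms it coincides with strong
normalisability. If an elimination of t is strongly normalising, so is t. Conversely, a strongly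
normalising term contains no `fix` (`SN.fixFree`), so the eliminations that test it are again well
typed and `fix`-free, and `HasType.sn` applies to them. -/

namespace DiffCalc

namespace Term

variable {C : Type u}

/-! ### Substitution calculus -/

/-- The substitution that sends the variable `0` to `s` and the variable `k + 1` to `σ k`. -/
def scons (s : Term C) (σ : ℕ → Term C) : ℕ → Term C
  | 0 => s
  | k + 1 => σ k

@[simp] theorem scons_zero (s : Term C) (σ : ℕ → Term C) : scons s σ 0 = s := rfl

@[simp] theorem scons_succ (s : Term C) (σ : ℕ → Term C) (k : ℕ) : scons s σ (k + 1) = σ k := rfl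

@[simp] theorem liftSub_zero (σ : ℕ → Term C) : liftSub σ 0 = var 0 := rfl

@[simp] theorem liftSub_succ (σ : ℕ → Term C) (k : ℕ) : liftSub σ (k + 1) = shift (σ k) := rfl

theorem inst_eq (t s : Term C) : inst t s = subst (scons s var) t := by
  unfold inst
  congr 1

theorem replace_eq (t s : Term C) :
    replace t s = subst (scons s fun k => var (k + 1)) t := by
  unfold replace
  congr 1

theorem liftSub_var_comp (ρ : ℕ → ℕ) :
    liftSub (fun k => (var (ρ k) : Term C)) = fun k => var (liftRen ρ k) := by
  funext k
  cases k <;> rfl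

theorem rename_eq_subst (ρ : ℕ → ℕ) (t : Term C) : rename ρ t = subst (fun k => var (ρ k)) t := by
  induction t generalizing ρ <;> simp_all [rename, subst, liftSub_var_comp]

theorem subst_var (t : Term C) : subst var t = t := by
  have h : liftSub (var : ℕ → Term C) = var := by
    funext k
    cases k <;> rfl
  induction t <;> simp_all [subst]

theorem liftSub_comp_liftRen (σ : ℕ → Term C) (ρ : ℕ → ℕ) :
    (fun k => liftSub σ (liftRen ρ k)) = liftSub fun k => σ (ρ k) := by
  funext k
  cases k <;> rfl

theorem subst_rename (σ : ℕ → Term C) (ρ : ℕ → ℕ) (t : Term C) :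
    subst σ (rename ρ t) = subst (fun k => σ (ρ k)) t := by
  induction t generalizing σ ρ <;> simp_all [rename, subst, liftSub_comp_liftRen]

theorem rename_rename (ρ' ρ : ℕ → ℕ) (t : Term C) :
    rename ρ' (rename ρ t) = rename (fun k => ρ' (ρ k)) t := by
  rw [rename_eq_subst ρ', subst_rename, rename_eq_subst]

theorem rename_liftSub (ρ : ℕ → ℕ) (σ : ℕ → Term C) :
    (fun k => rename (liftRen ρ) (liftSub σ k)) = liftSub fun k => rename ρ (σ k) := by
  funext k
  cases k with
  | zero => rfl
  | succ k => simp [shift, rename_rename, liftRen]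

theorem rename_subst (ρ : ℕ → ℕ) (σ : ℕ → Term C) (t : Term C) :
    rename ρ (subst σ t) = subst (fun k => rename ρ (σ k)) t := by
  induction t generalizing σ ρ <;> simp_all [rename, subst, rename_liftSub]

theorem subst_liftSub (τ σ : ℕ → Term C) :
    (fun k => subst (liftSub τ) (liftSub σ k)) = liftSub fun k => subst τ (σ k) := by
  funext k
  cases k with
  | zero => rfl
  | succ k => simp [shift, subst_rename, rename_subst]

theorem subst_subst (τ σ : ℕ → Term C) (t : Term C) :
    subst τ (subst σ t) = subst (fun k => subst τ (σ k)) t := by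
  induction t generalizing σ τ <;> simp_all [subst, subst_liftSub]

theorem subst_shift (σ : ℕ → Term C) (t : Term C) :
    subst σ (shift t) = subst (fun k => σ (k + 1)) t :=
  subst_rename σ Nat.succ t

@[simp] theorem subst_scons_shift (s : Term C) (σ : ℕ → Term C) (t : Term C) :
    subst (scons s σ) (shift t) = subst σ t :=
  subst_shift _ t

@[simp] theorem subst_liftSub_shift (σ : ℕ → Term C) (t : Term C) :
    subst (liftSub σ) (shift t) = shift (subst σ t) := by
  rw [subst_shift, shift, rename_subst]
  rfl

@[simp] theorem inst_shift (t s : Term C) : inst (shift t) s = t := by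
  rw [inst_eq, subst_scons_shift, subst_var]

theorem inst_subst_liftSub (σ : ℕ → Term C) (t u : Term C) :
    inst (subst (liftSub σ) t) u = subst (scons u σ) t := by
  rw [inst_eq, subst_subst]
  congr 1
  funext k
  cases k with
  | zero => rfl
  | succ k => simp [subst_var]

theorem subst_inst (σ : ℕ → Term C) (t s : Term C) :
    subst σ (inst t s) = inst (subst (liftSub σ) t) (subst σ s) := by
  rw [inst_subst_liftSub, inst_eq, subst_subst]
  congr 1
  funext k
  cases k <;> rfl

theorem subst_replace (σ : ℕ → Term C) (t s : Term C) :
    subst (liftSub σ) (replace t s) = replace (subst (liftSub σ) t) (subst (liftSub σ) s) := by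
  rw [replace_eq, replace_eq, subst_subst, subst_subst]
  congr 1
  funext k
  cases k with
  | zero => rfl
  | succ k =>
    simp only [scons_succ, liftSub_succ, subst_scons_shift, subst]
    exact rename_eq_subst _ _

/-- Turns a partial derivative or integral in the variable x_j back into an instance of the original
body at a whole tuple. -/
theorem inst_replace (t s u : Term C) : inst (replace t s) u = inst t (inst s u) := by
  rw [inst_eq, replace_eq, subst_subst, inst_eq]
  congr 1
  funext k
  cases k with
  | zero => exact (inst_eq s u).symm
  | succ k => rfl

theorem subst_swap (σ : ℕ → Term C) (t : Term C) :
    subst (liftSub (liftSub σ)) (swap t) = swap (subst (liftSub (liftSub σ)) t) := by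
  rw [swap, swap, subst_rename, rename_subst]
  congr 1
  funext k
  rcases k with _ | _ | k
  · rfl
  · rfl
  · simp [shift, rename_rename]

/-- Here u fills the variable of the abstraction and v the variable of the derivative or integral;
moving the operator under the λ exchanges the two binders but not these roles. -/
theorem inst_subst_swap (t u v : Term C) :
    inst (subst (liftSub (scons u var)) (swap t)) v =
      inst (subst (liftSub (scons v var)) t) u := by
  rw [inst_subst_liftSub, inst_subst_liftSub, swap, subst_rename]
  congr 1
  funext k
  rcases k with _ | _ | k <;> rfl

theorem subst_mixTup (σ : ℕ → Term C) {n : ℕ} (a b : Fin (n + 1) → Term C) (j : Fin (n + 1)) :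
    subst (liftSub σ) (mixTup a b j) =
      mixTup (fun i => subst σ (a i)) (fun i => subst σ (b i)) j := by
  simp only [mixTup, subst, tup.injEq, heq_eq_eq, true_and]
  funext i
  split_ifs <;> simp [subst]

theorem inst_mixTup {n : ℕ} (a b : Fin (n + 1) → Term C) (j : Fin (n + 1)) (u : Term C) :
    inst (mixTup a b j) u = tup fun i => if i < j then b i else if i = j then u else a i := by
  rw [inst_eq]
  simp only [mixTup, subst, tup.injEq, heq_eq_eq, true_and]
  funext i
  split_ifs <;> simp [subst, subst_var]

theorem subst_bigAdd (σ : ℕ → Term C) {n : ℕ} (ts : Fin (n + 1) → Term C) :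
    subst σ (bigAdd ts) = bigAdd fun i => subst σ (ts i) := by
  induction n with
  | zero => rfl
  | succ n ih => simp [bigAdd, subst, ih]

end Term

open Term

variable {C : Type u}

/-! ### Reduction -/

/-- The rules are schematic; those whose right-hand sides involve substitution, shifting, swapping
or iterated sums need the commutation lemmas above. -/
theorem Step.subst {t t' : Term C} (h : Step t t') (σ : ℕ → Term C) :
    Step (t.subst σ) (t'.subst σ) := by
  induction h generalizing σ with
  | beta => simpa only [Term.subst, subst_inst] using Step.beta
  | projTup => exact Step.projTup
  | caseInl => simpa only [Term.subst, subst_inst] using Step.caseInl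
  | caseInr => simpa only [Term.subst, subst_inst] using Step.caseInr
  | mulLam =>
    simpa only [Term.subst, subst_liftSub_shift] using Step.mulLam
  | mulTupTup =>
    simpa only [Term.subst, subst_bigAdd] using Step.mulTupTup
  | derivLam =>
    simpa only [Term.subst, subst_liftSub_shift, subst_swap] using Step.derivLam
  | derivAtTup =>
    simpa only [Term.subst, subst_replace, subst_mixTup] using Step.derivAtTup
  | integLam =>
    simpa only [Term.subst, subst_liftSub_shift, subst_swap] using Step.integLam
  | integAtTup =>
    simpa only [Term.subst, subst_bigAdd, subst_replace, subst_mixTup] using Step.integAtTup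
  | @inTup n ts t' i _ ih =>
    have := Step.inTup (ts := fun i => (ts i).subst σ) i (ih σ)
    simp only [Term.subst]
    convert this using 2
    funext k
    by_cases hk : k = i
    · subst hk; simp
    · simp [hk]
  | _ => simp only [Term.subst]; constructor <;> apply_assumption

theorem Step.inst {t t' : Term C} (h : Step t t') (u : Term C) :
    Step (t.inst u) (t'.inst u) :=
  h.subst _

theorem SN.step {t t' : Term C} (ht : SN t) (h : Step t t') : SN t' :=
  Acc.inv ht h

/-- A map that preserves reduction reflects strong normalisability. -/
theorem SN.of_map (f : Term C → Term C) (hf : ∀ t t', Step t t' → Step (f t) (f t'))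
    {t : Term C} (h : SN (f t)) : SN t := by
  generalize hs : f t = s at h
  induction h generalizing t with
  | intro s _ ih =>
    subst hs
    exact ⟨_, fun t' ht' => ih _ (hf _ _ ht') rfl⟩

theorem SN.of_inst {t u : Term C} (h : SN (t.inst u)) : SN t :=
  SN.of_map (fun t => t.inst u) (fun _ _ h => h.inst u) h

/-- Unfolding the innermost `fix` again and again gives f(f(⋯(fix f))) without end. -/
theorem not_sn_fixp (f : Term C) : ¬ SN (fixp f) := by
  have hstep : ∀ n : ℕ, Step ((app f)^[n] (fixp f)) ((app f)^[n + 1] (fixp f)) := by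
    intro n
    induction n with
    | zero => exact Step.fixUnfold
    | succ n ih =>
      rw [Function.iterate_succ_apply', Function.iterate_succ_apply' _ (n + 1)]
      exact Step.inAppR ih
  have key : ∀ t : Term C, SN t → ∀ n : ℕ, (app f)^[n] (fixp f) ≠ t := by
    intro t ht
    induction ht with
    | intro t _ ih =>
      rintro n rfl
      exact ih _ (hstep n) (n + 1) rfl
  exact fun h => key _ h 0 rfl

/-- Reduction is closed under contexts, so subterms of a strongly normalising term are strongly
normalising. This matters because the arguments quantified over in reducibility at a function type
are not assumed free of `fix`. -/
theorem SN.fixFree {t : Term C} (h : SN t) : t.FixFree := by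
  induction t with
  | const | var => trivial
  | lam A t ih => exact ih (SN.of_map (lam A) (fun _ _ => .inLam) h)
  | app t s iht ihs =>
    exact ⟨iht (SN.of_map (app · s) (fun _ _ => .inAppL) h),
      ihs (SN.of_map (app t) (fun _ _ => .inAppR) h)⟩
  | tup ts ih =>
    intro i
    refine ih i (SN.of_map (fun u => tup (Function.update ts i u)) (fun u u' hu => ?_) ?_)
    · have := Step.inTup (ts := Function.update ts i u) (t' := u') i (by simpa using hu)
      simpa using this
    · simpa using h
  | proj j t ih => exact ih (SN.of_map (proj j) (fun _ _ => .inProj) h)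
  | inl t ih => exact ih (SN.of_map inl (fun _ _ => .inInl) h)
  | inr t ih => exact ih (SN.of_map inr (fun _ _ => .inInr) h)
  | caseOf t a b iht iha ihb =>
    exact ⟨iht (SN.of_map (caseOf · a b) (fun _ _ => .inCase) h),
      iha (SN.of_map (caseOf t · b) (fun _ _ => .inCaseL) h),
      ihb (SN.of_map (caseOf t a) (fun _ _ => .inCaseR) h)⟩
  | add t s iht ihs =>
    exact ⟨iht (SN.of_map (add · s) (fun _ _ => .inAddL) h),
      ihs (SN.of_map (add t) (fun _ _ => .inAddR) h)⟩
  | sub t s iht ihs =>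
    exact ⟨iht (SN.of_map (sub · s) (fun _ _ => .inSubL) h),
      ihs (SN.of_map (sub t) (fun _ _ => .inSubR) h)⟩
  | mul S t s iht ihs =>
    exact ⟨iht (SN.of_map (mul S · s) (fun _ _ => .inMulL) h),
      ihs (SN.of_map (mul S t) (fun _ _ => .inMulR) h)⟩
  | deriv S t s iht ihs =>
    exact ⟨iht (SN.of_map (deriv S · s) (fun _ _ => .inDerivL) h),
      ihs (SN.of_map (deriv S t) (fun _ _ => .inDerivR) h)⟩
  | integ S a b t iha ihb iht =>
    exact ⟨iha (SN.of_map (integ S · b t) (fun _ _ => .inIntegL) h),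
      ihb (SN.of_map (integ S a · t) (fun _ _ => .inIntegR) h),
      iht (SN.of_map (integ S a b) (fun _ _ => .inInteg) h)⟩
  | fixp f => exact (not_sn_fixp f h).elim

/-! ### A strong notion of reducibility -/

/-- Strong normalisability, where moreover all reducts satisfy `P`. -/
inductive Hereditary (P : Term C → Prop) : Term C → Prop
  | intro {t : Term C} : P t → (∀ t', Step t t' → Hereditary P t') → Hereditary P t

/-- Abstractions, tuples and injections. -/
def IsIntro : Term C → Prop
  | lam _ _ => True
  | tup _ => True
  | inl _ => True
  | inr _ => True
  | _ => False

/-- `t` is strongly normalising, and every value that it reduces to is a value of the shape that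
the type prescribes, with good components. Terms need not be well typed. -/
def Good : Ty → Term C → Prop
  | .base => Hereditary fun t => ¬ IsIntro t
  | .tup (n := n) Ts => Hereditary fun t => IsIntro t → ∃ ts : Fin (n + 1) → Term C,
      t = tup ts ∧ ∀ i, Good (Ts i) (ts i)
  | .arrow A B => Hereditary fun t => IsIntro t → ∃ A' t', t = lam A' t' ∧
      ∀ u, Good A u → Good B (inst t' u)
  | .sum A B => Hereditary fun t => IsIntro t →
      (∃ u, t = inl u ∧ Good A u) ∨ ∃ u, t = inr u ∧ Good B u

/-- The condition on values that is used in the definition of `Good`. -/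
def GoodValue : Ty → Term C → Prop
  | .base, t => ¬ IsIntro t
  | .tup (n := n) Ts, t => IsIntro t → ∃ ts : Fin (n + 1) → Term C,
      t = tup ts ∧ ∀ i, Good (Ts i) (ts i)
  | .arrow A B, t => IsIntro t → ∃ A' t', t = lam A' t' ∧
      ∀ u, Good A u → Good B (inst t' u)
  | .sum A B, t => IsIntro t →
      (∃ u, t = inl u ∧ Good A u) ∨ ∃ u, t = inr u ∧ Good B u

/-- The uniform shape lets closure under reduction be proved without splitting on the type. -/
theorem good_eq (T : Ty) : (Good T : Term C → Prop) = Hereditary (GoodValue T) := by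
  cases T <;> rw [Good] <;> rfl

namespace Good

theorem value {T : Ty} {t : Term C} (h : Good T t) : GoodValue T t := by
  rw [good_eq] at h
  cases h; assumption

theorem step {T : Ty} {t t' : Term C} (h : Good T t) (hs : Step t t') : Good T t' := by
  rw [good_eq] at h ⊢
  cases h with
  | intro _ h => exact h _ hs

theorem mk {T : Ty} {t : Term C} (hv : GoodValue T t) (h : ∀ t', Step t t' → Good T t') :
    Good T t := by
  rw [good_eq] at h ⊢
  exact .intro hv h

/-- The analogue of Girard's condition CR3: for a term that is not an introduction the value
condition is vacuous. -/
theorem of_neutral {T : Ty} {t : Term C} (hn : ¬ IsIntro t) (h : ∀ t', Step t t' → Good T t') :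
    Good T t :=
  mk (by cases T <;> simp [GoodValue, hn]) h

theorem sn {T : Ty} {t : Term C} (h : Good T t) : SN t := by
  rw [good_eq] at h
  induction h with
  | intro _ _ ih => exact ⟨_, ih⟩

theorem var (T : Ty) (k : ℕ) : Good T (var k : Term C) :=
  of_neutral id fun _ h => nomatch h

theorem const (T : Ty) (c : C) : Good T (const c) :=
  of_neutral id fun _ h => nomatch h

/-! Values at the various types. -/

/-- The inversion lemmas replace typing inversion: a good introduction form determines the outer
shape of its type. The annotation A' plays no role. -/
theorem lam_inv {T : Ty} {A' : Ty} {t : Term C} (h : Good T (lam A' t)) :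
    ∃ A B, T = .arrow A B ∧ ∀ u, Good A u → Good B (t.inst u) := by
  have hv := h.value
  cases T with
  | base => exact (hv trivial).elim
  | tup Ts => obtain ⟨_, h, _⟩ := hv trivial; cases h
  | arrow A B => obtain ⟨_, _, h, h'⟩ := hv trivial; cases h; exact ⟨A, B, rfl, h'⟩
  | sum A B => obtain ⟨_, h, _⟩ | ⟨_, h, _⟩ := hv trivial <;> cases h

theorem tup_inv {T : Ty} {n : ℕ} {ts : Fin (n + 1) → Term C} (h : Good T (tup ts)) :
    ∃ Ts : Fin (n + 1) → Ty, T = .tup Ts ∧ ∀ i, Good (Ts i) (ts i) := by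
  have hv := h.value
  cases T with
  | base => exact (hv trivial).elim
  | tup Ts => obtain ⟨_, h, h'⟩ := hv trivial; cases h; exact ⟨Ts, rfl, h'⟩
  | arrow A B => obtain ⟨_, _, h, _⟩ := hv trivial; cases h
  | sum A B => obtain ⟨_, h, _⟩ | ⟨_, h, _⟩ := hv trivial <;> cases h

theorem inl_inv {T : Ty} {t : Term C} (h : Good T (inl t)) :
    ∃ A B, T = .sum A B ∧ Good A t := by
  have hv := h.value
  cases T with
  | base => exact (hv trivial).elim
  | tup Ts => obtain ⟨_, h, _⟩ := hv trivial; cases h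
  | arrow A B => obtain ⟨_, _, h, _⟩ := hv trivial; cases h
  | sum A B =>
    obtain ⟨_, h, h'⟩ | ⟨_, h, _⟩ := hv trivial <;> cases h
    exact ⟨A, B, rfl, h'⟩

theorem inr_inv {T : Ty} {t : Term C} (h : Good T (inr t)) :
    ∃ A B, T = .sum A B ∧ Good B t := by
  have hv := h.value
  cases T with
  | base => exact (hv trivial).elim
  | tup Ts => obtain ⟨_, h, _⟩ := hv trivial; cases h
  | arrow A B => obtain ⟨_, _, h, _⟩ := hv trivial; cases h
  | sum A B =>
    obtain ⟨_, h, _⟩ | ⟨_, h, h'⟩ := hv trivial <;> cases h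
    exact ⟨A, B, rfl, h'⟩

/-- Variables are good at every type, so a body may be tested on one; this supplies the induction on
reductions under a binder. -/
theorem sn_of_body {S T : Ty} {t : Term C} (h : ∀ u, Good S u → Good T (t.inst u)) : SN t :=
  SN.of_inst (h _ (var S 0)).sn

theorem lam {A B A' : Ty} {t : Term C} (h : ∀ u, Good A u → Good B (t.inst u)) :
    Good (.arrow A B) (lam A' t) := by
  have hsn := sn_of_body h
  induction hsn with
  | intro t _ ih =>
    refine mk (fun _ => ⟨_, _, rfl, h⟩) fun t' ht' => ?_
    cases ht' with
    | inLam hs => exact ih _ hs fun u hu => (h u hu).step (hs.inst u)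

theorem inl {A B : Ty} {t : Term C} (h : Good A t) : Good (.sum A B) (inl t) := by
  have hsn := h.sn
  induction hsn with
  | intro t _ ih =>
    refine mk (fun _ => .inl ⟨_, rfl, h⟩) fun t' ht' => ?_
    cases ht' with
    | inInl hs => exact ih _ hs (h.step hs)

theorem inr {A B : Ty} {t : Term C} (h : Good B t) : Good (.sum A B) (inr t) := by
  have hsn := h.sn
  induction hsn with
  | intro t _ ih =>
    refine mk (fun _ => .inr ⟨_, rfl, h⟩) fun t' ht' => ?_
    cases ht' with
    | inInr hs => exact ih _ hs (h.step hs)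

/-- Reduction in one component of a finite family is well founded on families of strongly
normalisable terms. -/
theorem acc_update {ι : Type*} [Finite ι] [DecidableEq ι] {ts : ι → Term C}
    (h : ∀ i, SN (ts i)) :
    Acc (fun ss ts : ι → Term C => ∃ i u, Step (ts i) u ∧ ss = Function.update ts i u) ts := by
  cases nonempty_fintype ι
  have key : ∀ (s : Finset ι) (ts : ι → Term C), (∀ i ∈ s, SN (ts i)) →
      Acc (fun ss ts : ι → Term C =>
        ∃ i ∈ s, ∃ u, Step (ts i) u ∧ ss = Function.update ts i u) ts := by
    -- Only coordinates in s may move. Adding a uses a lexicographic induction: outside on the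
    -- reductions of coordinate a, inside on those of the coordinates in s.
    intro s
    induction s using Finset.induction_on with
    | empty => exact fun ts _ => ⟨_, by simp⟩
    | insert a s has ih =>
      intro ts h
      have ha := h a (s.mem_insert_self a)
      generalize hv : ts a = v at ha
      induction ha generalizing ts with
      | intro v _ ihv =>
        have hacc := ih ts fun i hi => h i (Finset.mem_insert_of_mem hi)
        induction hacc with
        | intro ts _ ihts =>
          refine ⟨_, ?_⟩
          rintro _ ⟨i, hi, u, hu, rfl⟩
          have h' : ∀ k ∈ insert a s, SN (Function.update ts i u k) := by
            intro k hk
            by_cases hki : k = i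
            · subst hki; simpa using (h k hk).step hu
            · simpa [hki] using h k hk
          obtain rfl | hi := Finset.mem_insert.mp hi
          · exact ihv u (hv ▸ hu) _ h' (by simp)
          · refine ihts _ ⟨i, hi, u, hu, rfl⟩ h' ?_
            rwa [Function.update_of_ne (show a ≠ i from fun hai => has (hai ▸ hi))]
  simpa using key Finset.univ ts fun i _ => h i

theorem tup {n : ℕ} {Ts : Fin (n + 1) → Ty} {ts : Fin (n + 1) → Term C}
    (h : ∀ i, Good (Ts i) (ts i)) : Good (.tup Ts) (tup ts) := by
  have hacc := acc_update fun i => (h i).sn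
  induction hacc with
  | intro ts _ ih =>
    refine mk (fun _ => ⟨_, rfl, h⟩) fun t' ht' => ?_
    cases ht' with
    | inTup i hs =>
      refine ih _ ⟨i, _, hs, rfl⟩ fun k => ?_
      by_cases hk : k = i
      · subst hk; simpa using (h k).step hs
      · simpa [hk] using h k

/-! Eliminations. -/

/-- Reductions inside t or s fall to the nested inductions; a root β-step is exactly what the value
condition at a function type covers. -/
theorem app {A B : Ty} {t s : Term C} (ht : Good (.arrow A B) t) (hs : Good A s) :
    Good B (app t s) := by
  have ht' := ht.sn
  induction ht' generalizing s with
  | intro t _ iht =>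
    have hs' := hs.sn
    induction hs' with
    | intro s _ ihs =>
      refine of_neutral id fun r hr => ?_
      cases hr with
      | beta => obtain ⟨_, _, h, h'⟩ := ht.lam_inv; cases h; exact h' _ hs
      | inAppL h => exact iht _ h (ht.step h) hs
      | inAppR h => exact ihs _ h (hs.step h)

theorem proj {n : ℕ} {Ts : Fin (n + 1) → Ty} {t : Term C} (j : Fin (n + 1))
    (ht : Good (.tup Ts) t) : Good (Ts j) (proj j t) := by
  have ht' := ht.sn
  induction ht' with
  | intro t _ iht =>
    refine of_neutral id fun r hr => ?_
    cases hr with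
    | projTup => obtain ⟨_, h, h'⟩ := ht.tup_inv; cases h; exact h' _
    | inProj h => exact iht _ h (ht.step h)

theorem caseOf {A B T : Ty} {t a b : Term C} (ht : Good (.sum A B) t)
    (ha : ∀ u, Good A u → Good T (a.inst u)) (hb : ∀ u, Good B u → Good T (b.inst u)) :
    Good T (caseOf t a b) := by
  have ht' := ht.sn
  induction ht' generalizing a b with
  | intro t _ iht =>
    have ha' := sn_of_body ha
    induction ha' generalizing b with
    | intro a _ iha =>
      have hb' := sn_of_body hb
      induction hb' with
      | intro b _ ihb =>
        refine of_neutral id fun r hr => ?_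
        cases hr with
        | caseInl => obtain ⟨_, _, h, h'⟩ := ht.inl_inv; cases h; exact ha _ h'
        | caseInr => obtain ⟨_, _, h, h'⟩ := ht.inr_inv; cases h; exact hb _ h'
        | inCase h => exact iht _ h (ht.step h) ha hb
        | inCaseL h => exact iha _ h (fun u hu => (ha u hu).step (h.inst u)) hb
        | inCaseR h => exact ihb _ h fun u hu => (hb u hu).step (h.inst u)

/-! Linear operations. -/

/-- Root rules exist only for tuples and abstractions and lead to smaller types. A sum of injections
has no root step, hence is harmless. -/
theorem add {T : Ty} {t s : Term C} (ht : Good T t) (hs : Good T s) : Good T (add t s) := by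
  induction T generalizing t s with
  | _ =>
    have ht' := ht.sn
    induction ht' generalizing s with
    | intro t _ iht =>
      have hs' := hs.sn
      induction hs' with
      | intro s _ ihs =>
        refine of_neutral id fun r hr => ?_
        cases hr with
        | addTup =>
          obtain ⟨_, h, h₁⟩ := ht.tup_inv
          -- The same script runs for every constructor of T; the equation of types discards all but
          -- the tuple case, and `all_goals` then acts on what is left.
          cases h
          all_goals
            obtain ⟨_, h, h₂⟩ := hs.tup_inv
            cases h
            exact tup fun i => by apply_assumption; exacts [h₁ i, h₂ i]
        | addLam =>
          obtain ⟨_, _, h, h₁⟩ := ht.lam_inv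
          cases h
          all_goals
            obtain ⟨_, _, h, h₂⟩ := hs.lam_inv
            cases h
            exact lam fun u hu => by apply_assumption; exacts [h₁ u hu, h₂ u hu]
        | inAddL h => exact iht _ h (ht.step h) hs
        | inAddR h => exact ihs _ h (hs.step h)

theorem sub {T : Ty} {t s : Term C} (ht : Good T t) (hs : Good T s) : Good T (sub t s) := by
  induction T generalizing t s with
  | _ =>
    have ht' := ht.sn
    induction ht' generalizing s with
    | intro t _ iht =>
      have hs' := hs.sn
      induction hs' with
      | intro s _ ihs =>
        refine of_neutral id fun r hr => ?_
        cases hr with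
        | subTup =>
          obtain ⟨_, h, h₁⟩ := ht.tup_inv
          cases h
          all_goals
            obtain ⟨_, h, h₂⟩ := hs.tup_inv
            cases h
            exact tup fun i => by apply_assumption; exacts [h₁ i, h₂ i]
        | subLam =>
          obtain ⟨_, _, h, h₁⟩ := ht.lam_inv
          cases h
          all_goals
            obtain ⟨_, _, h, h₂⟩ := hs.lam_inv
            cases h
            exact lam fun u hu => by apply_assumption; exacts [h₁ u hu, h₂ u hu]
        | inSubL h => exact iht _ h (ht.step h) hs
        | inSubR h => exact ihs _ h (hs.step h)

theorem bigAdd {T : Ty} {n : ℕ} {ts : Fin (n + 1) → Term C} (h : ∀ i, Good T (ts i)) :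
    Good T (bigAdd ts) := by
  induction n with
  | zero => exact h 0
  | succ n ih => exact add (ih fun i => h _) (h _)

/-- The factor s is only copied into components, never inspected, so strong normalisability suffices
for it. -/
theorem mul_base {T : Ty} {t s : Term C} (ht : Good T t) (hs : SN s) :
    Good T (mul .base t s) := by
  induction T generalizing t s with
  | _ =>
    have ht' := ht.sn
    induction ht' generalizing s with
    | intro t _ iht =>
      induction hs with
      | intro s hs ihs =>
        replace hs : SN s := ⟨_, hs⟩
        refine of_neutral id fun r hr => ?_
        cases hr with
        | mulTup =>
          obtain ⟨_, h, h₁⟩ := ht.tup_inv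
          cases h
          all_goals exact tup fun i => by apply_assumption; exacts [h₁ i, hs]
        | mulLam =>
          obtain ⟨_, _, h, h₁⟩ := ht.lam_inv
          cases h
          all_goals
            refine lam fun u hu => ?_
            change Good _ (Term.mul _ (Term.inst _ u) (Term.inst (shift s) u))
            rw [inst_shift]
            apply_assumption
            exacts [h₁ u hu, hs]
        | mulInl =>
          obtain ⟨_, _, h, h₁⟩ := ht.inl_inv
          cases h
          all_goals exact inl (by apply_assumption; exacts [h₁, hs])
        | mulInr =>
          obtain ⟨_, _, h, h₁⟩ := ht.inr_inv
          cases h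
          all_goals exact inr (by apply_assumption; exacts [h₁, hs])
        | inMulL h => exact iht _ h (ht.step h) hs
        | inMulR h => exact ihs _ h

theorem deriv_base {T : Ty} {t s : Term C} (ht : ∀ u, Good .base u → Good T (t.inst u))
    (hs : SN s) : Good T (deriv .base t s) := by
  induction T generalizing t s with
  | _ =>
    have ht' := sn_of_body ht
    induction ht' generalizing s with
    | intro t _ iht =>
      induction hs with
      | intro s hs ihs =>
        replace hs : SN s := ⟨_, hs⟩
        refine of_neutral id fun r hr => ?_
        cases hr with
        | derivTup =>
          -- The instance at a variable serves only to reveal the shape of T; the goodness of the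
          -- components is read off later from each instance separately.
          obtain ⟨_, h, -⟩ := (ht _ (var _ 0)).tup_inv
          cases h
          all_goals
            refine tup fun i => ?_
            apply_assumption
            · intro u hu
              obtain ⟨_, h, h'⟩ := (ht u hu).tup_inv
              cases h
              exact h' i
            · exact hs
        | derivLam =>
          obtain ⟨_, _, h, -⟩ := (ht _ (var _ 0)).lam_inv
          cases h
          all_goals
            refine lam fun u hu => ?_
            rw [inst_eq]
            simp only [Term.subst, subst_scons_shift, subst_var]
            apply_assumption
            · intro v hv
              rw [inst_subst_swap]
              have := ht v hv
              rw [inst_eq] at this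
              obtain ⟨_, _, h, h'⟩ := this.lam_inv
              cases h
              exact h' u hu
            · exact hs
        | derivInl =>
          obtain ⟨_, _, h, -⟩ := (ht _ (var _ 0)).inl_inv
          cases h
          all_goals
            refine inl ?_
            apply_assumption
            · intro u hu
              obtain ⟨_, _, h, h'⟩ := (ht u hu).inl_inv
              cases h
              exact h'
            · exact hs
        | derivInr =>
          obtain ⟨_, _, h, -⟩ := (ht _ (var _ 0)).inr_inv
          cases h
          all_goals
            refine inr ?_
            apply_assumption
            · intro u hu
              obtain ⟨_, _, h, h'⟩ := (ht u hu).inr_inv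
              cases h
              exact h'
            · exact hs
        | inDerivL h => exact iht _ h (fun u hu => (ht u hu).step (h.inst u)) hs
        | inDerivR h => exact ihs _ h

theorem integ_base {T : Ty} {a b t : Term C} (ha : SN a) (hb : SN b)
    (ht : ∀ u, Good .base u → Good T (t.inst u)) : Good T (integ .base a b t) := by
  induction T generalizing a b t with
  | _ =>
    have ht' := sn_of_body ht
    induction ht' generalizing a b with
    | intro t _ iht =>
      induction ha generalizing b with
      | intro a ha iha =>
        replace ha : SN a := ⟨_, ha⟩
        induction hb with
        | intro b hb ihb =>
          replace hb : SN b := ⟨_, hb⟩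
          refine of_neutral id fun r hr => ?_
          cases hr with
          | integTup =>
            obtain ⟨_, h, -⟩ := (ht _ (var _ 0)).tup_inv
            cases h
            all_goals
              refine tup fun i => ?_
              apply_assumption
              · exact ha
              · exact hb
              · intro u hu
                obtain ⟨_, h, h'⟩ := (ht u hu).tup_inv
                cases h
                exact h' i
          | integLam =>
            obtain ⟨_, _, h, -⟩ := (ht _ (var _ 0)).lam_inv
            cases h
            all_goals
              refine lam fun u hu => ?_
              rw [inst_eq]
              simp only [Term.subst, subst_scons_shift, subst_var]
              apply_assumption
              · exact ha
              · exact hb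
              · intro v hv
                rw [inst_subst_swap]
                have := ht v hv
                rw [inst_eq] at this
                obtain ⟨_, _, h, h'⟩ := this.lam_inv
                cases h
                exact h' u hu
          | integInl =>
            obtain ⟨_, _, h, -⟩ := (ht _ (var _ 0)).inl_inv
            cases h
            all_goals
              refine inl ?_
              apply_assumption
              · exact ha
              · exact hb
              · intro u hu
                obtain ⟨_, _, h, h'⟩ := (ht u hu).inl_inv
                cases h
                exact h'
          | integInr =>
            obtain ⟨_, _, h, -⟩ := (ht _ (var _ 0)).inr_inv
            cases h
            all_goals
              refine inr ?_
              apply_assumption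
              · exact ha
              · exact hb
              · intro u hu
                obtain ⟨_, _, h, h'⟩ := (ht u hu).inr_inv
                cases h
                exact h'
          | inIntegL h => exact iha _ h hb
          | inIntegR h => exact ihb _ h
          | inInteg h => exact iht _ h ha hb fun u hu => (ht u hu).step (h.inst u)

end Good

/-- Differentiation in a variable of base type does not change the type. -/
theorem IsDeriv.eq_of_base {T D : Ty} (h : IsDeriv T .base D) : D = T := by
  generalize hS : Ty.base = S at h
  induction h with
  | base => rfl
  | tup _ ih => exact congrArg Ty.tup (funext fun i => ih i rfl)
  | arrow _ ih => rw [ih rfl]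
  | sum _ _ ih₁ ih₂ => rw [ih₁ rfl, ih₂ rfl]
  | wrtTup => cases hS

/-- Types built from the base type by tuples, as an induction principle for `IsDeriv`. -/
theorem IsDeriv.induction_right {motive : ∀ T S D : Ty, IsDeriv T S D → Prop}
    (base : ∀ T (h : IsDeriv T .base T), motive T .base T h)
    (tup : ∀ (T : Ty) {n : ℕ} (Ss Ds : Fin (n + 1) → Ty) (h : ∀ i, IsDeriv T (Ss i) (Ds i)),
      (∀ i, motive T (Ss i) (Ds i) (h i)) → motive T (.tup Ss) (.tup Ds) (.wrtTup h))
    {T S D : Ty} (h : IsDeriv T S D) : motive T S D h := by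
  -- All constructors with S the base type collapse into one case, since there D = T.
  have aux : ∀ {T D : Ty} (h : IsDeriv T .base D), motive T .base D h := fun h => by
    obtain rfl := h.eq_of_base
    exact base _ h
  induction h with
  | wrtTup h ih => exact tup _ _ _ h ih
  | _ => exact aux _

/-! ### Product, derivative and integral over tuple-built types -/

namespace Good

theorem mul {T S D : Ty} (hD : IsDeriv T S D) {t s : Term C} (ht : Good D t) (hs : Good S s) :
    Good T (mul S t s) := by
  induction hD using IsDeriv.induction_right generalizing t s with
  | base T _ => exact mul_base ht hs.sn
  | tup T Ss Ds _ ih =>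
    have ht' := ht.sn
    induction ht' generalizing s with
    | intro t _ iht =>
      have hs' := hs.sn
      induction hs' with
      | intro s _ ihs =>
        refine of_neutral id fun r hr => ?_
        cases hr with
        | mulTupTup =>
          obtain ⟨_, h, h₁⟩ := ht.tup_inv
          cases h
          obtain ⟨_, h, h₂⟩ := hs.tup_inv
          cases h
          exact bigAdd fun j => ih j (h₁ j) (h₂ j)
        | inMulL h => exact iht _ h (ht.step h) hs
        | inMulR h => exact ihs _ h (hs.step h)

/-- Filling x_j with a good term makes the mixed tuple good in every entry, so the hypothesis on t
applies to it. -/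
theorem inst_replace_mixTup {n : ℕ} {Ss : Fin (n + 1) → Ty} {T : Ty} {t : Term C}
    {as bs : Fin (n + 1) → Term C} (ht : ∀ u, Good (.tup Ss) u → Good T (t.inst u))
    (ha : ∀ i, Good (Ss i) (as i)) (hb : ∀ i, Good (Ss i) (bs i)) (j : Fin (n + 1))
    (u : Term C) (hu : Good (Ss j) u) : Good T ((replace t (mixTup as bs j)).inst u) := by
  rw [inst_replace, inst_mixTup]
  refine ht _ (tup fun i => ?_)
  split_ifs with h₁ h₂
  · exact hb i
  · exact h₂ ▸ hu
  · exact ha i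

theorem deriv {T S D : Ty} (hD : IsDeriv T S D) {t s : Term C}
    (ht : ∀ u, Good S u → Good T (t.inst u)) (hs : Good S s) : Good D (deriv S t s) := by
  induction hD using IsDeriv.induction_right generalizing t s with
  | base T _ => exact deriv_base ht hs.sn
  | tup T Ss Ds _ ih =>
    have ht' := sn_of_body ht
    induction ht' generalizing s with
    | intro t _ iht =>
      have hs' := hs.sn
      induction hs' with
      | intro s _ ihs =>
        refine of_neutral id fun r hr => ?_
        cases hr with
        | derivAtTup =>
          obtain ⟨_, h, h'⟩ := hs.tup_inv
          cases h
          exact tup fun j => ih j (inst_replace_mixTup ht h' h' j) (h' j)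
        | inDerivL h => exact iht _ h (fun u hu => (ht u hu).step (h.inst u)) hs
        | inDerivR h => exact ihs _ h (hs.step h)

theorem integ {T S D : Ty} (hD : IsDeriv T S D) {a b t : Term C} (ha : Good S a) (hb : Good S b)
    (ht : ∀ u, Good S u → Good D (t.inst u)) : Good T (integ S a b t) := by
  induction hD using IsDeriv.induction_right generalizing a b t with
  | base T _ => exact integ_base ha.sn hb.sn ht
  | tup T Ss Ds _ ih =>
    have ht' := sn_of_body ht
    induction ht' generalizing a b with
    | intro t _ iht =>
      have ha' := ha.sn
      induction ha' generalizing b with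
      | intro a _ iha =>
        have hb' := hb.sn
        induction hb' with
        | intro b _ ihb =>
          refine of_neutral id fun r hr => ?_
          cases hr with
          | integAtTup =>
            obtain ⟨_, h, h₁⟩ := ha.tup_inv
            cases h
            obtain ⟨_, h, h₂⟩ := hb.tup_inv
            cases h
            exact bigAdd fun j => ih j (h₁ j) (h₂ j) fun u hu =>
              proj j (inst_replace_mixTup ht h₁ h₂ j u hu)
          | inIntegL h => exact iha _ h (ha.step h) hb
          | inIntegR h => exact ihb _ h (hb.step h)
          | inInteg h => exact iht _ h ha hb fun u hu => (ht u hu).step (h.inst u)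

end Good

/-! ### Strong normalisation and reducibility of well-typed terms -/

/-- The fundamental lemma, by induction on typing. The substitution is general so that, under a
binder, it can be extended by an arbitrary good term. -/
theorem HasType.good_subst {Γ : List Ty} {t : Term C} {T : Ty} (h : HasType Γ t T)
    (hf : t.FixFree) {σ : ℕ → Term C} (hσ : ∀ k A, Γ[k]? = some A → Good A (σ k)) :
    Good T (t.subst σ) := by
  have key : ∀ {Γ : List Ty} {σ : ℕ → Term C} {A B : Ty} {t : Term C},
      (∀ k A, Γ[k]? = some A → Good A (σ k)) →
      (∀ {σ : ℕ → Term C}, (∀ k B, (A :: Γ)[k]? = some B → Good B (σ k)) →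
        Good B (t.subst σ)) →
      ∀ u, Good A u → Good B ((t.subst (liftSub σ)).inst u) := by
    intro Γ σ A B t hσ h u hu
    rw [inst_subst_liftSub]
    refine h fun k B hk => ?_
    cases k with
    | zero => cases hk; exact hu
    | succ k => exact hσ k B hk
  induction h generalizing σ with
  | const c => exact Good.const _ c
  | var h => exact hσ _ _ h
  | lam _ ih => exact Good.lam (key hσ (ih hf))
  | app _ _ iht ihs => exact Good.app (iht hf.1 hσ) (ihs hf.2 hσ)
  | tup _ ih => exact Good.tup fun i => ih i (hf i) hσ
  | proj j _ ih => exact Good.proj j (ih hf hσ)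
  | inl _ ih => exact Good.inl (ih hf hσ)
  | inr _ ih => exact Good.inr (ih hf hσ)
  | caseOf _ _ _ iht iha ihb =>
    exact Good.caseOf (iht hf.1 hσ) (key hσ (iha hf.2.1)) (key hσ (ihb hf.2.2))
  | add _ _ iht ihs => exact Good.add (iht hf.1 hσ) (ihs hf.2 hσ)
  | sub _ _ iht ihs => exact Good.sub (iht hf.1 hσ) (ihs hf.2 hσ)
  | mul hD _ _ iht ihs => exact Good.mul hD (iht hf.1 hσ) (ihs hf.2 hσ)
  | deriv hD _ _ iht ihs => exact Good.deriv hD (key hσ (iht hf.1)) (ihs hf.2 hσ)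
  | integ hD _ _ _ iha ihb iht =>
    exact Good.integ hD (iha hf.1 hσ) (ihb hf.2.1 hσ) (key hσ (iht hf.2.2))
  | fixp => exact hf.elim

theorem HasType.sn {Γ : List Ty} {t : Term C} {T : Ty} (h : HasType Γ t T) (hf : t.FixFree) :
    SN t := by
  have := (h.good_subst hf (σ := Term.var) fun k A _ => Good.var A k).sn
  rwa [subst_var] at this

theorem HasType.append {Γ : List Ty} {t : Term C} {T : Ty} (h : HasType Γ t T) (Δ : List Ty) :
    HasType (Γ ++ Δ) t T := by
  induction h with
  | var h =>
    refine .var ?_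
    rw [List.getElem?_append_left (List.getElem?_eq_some_iff.mp h).1, h]
  | mul hD _ _ iht ihs => exact .mul hD iht ihs
  | deriv hD _ _ iht ihs => exact .deriv hD iht ihs
  | integ hD _ _ _ iha ihb iht => exact .integ hD iha ihb iht
  | caseOf _ _ _ iht iha ihb => exact .caseOf iht iha ihb
  | app _ _ iht ihs => exact .app iht ihs
  | _ => constructor <;> assumption

/-- The reducible terms are exactly the strongly normalisable ones among the well-typed terms. -/
theorem red_iff [Zero C] {T : Ty} {Γ : List Ty} {t : Term C} :
    Red T Γ t ↔ HasType Γ t T ∧ SN t := by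
  induction T generalizing Γ t with
  | base => rfl
  | tup Ts ih =>
    rw [Red]
    refine and_congr_right fun ht => ⟨fun h => ?_, fun h j => ?_⟩
    -- Tuples are nonempty, so there is a projection 0 to test on.
    · exact SN.of_map (proj 0) (fun _ _ => .inProj) ((ih 0).mp (h 0)).2
    · have hj := HasType.proj j ht
      exact (ih j).mpr ⟨hj, hj.sn h.fixFree⟩
  | arrow A B ihA ihB =>
    rw [Red]
    refine and_congr_right fun ht => ⟨fun h => ?_, fun h Δ s hs => ?_⟩
    -- A fresh variable of type A at the end of the context is a reducible argument; this is where
    -- the extra free variables Δ are needed.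
    · have hv : HasType (Γ ++ [A]) (var Γ.length : Term C) A := .var (by simp)
      exact SN.of_map (app · (var Γ.length)) (fun _ _ => .inAppL)
        (ihB.mp (h [A] _ (ihA.mpr ⟨hv, hv.sn trivial⟩))).2
    · obtain ⟨hs, hs'⟩ := ihA.mp hs
      have ha := HasType.app (ht.append Δ) hs
      exact ihB.mpr ⟨ha, ha.sn ⟨h.fixFree, hs'.fixFree⟩⟩
  | sum A B =>
    rw [Red]
    refine and_congr_right fun ht => ⟨fun h => ?_, fun h => ?_⟩
    · exact SN.of_map (caseOf · (const 0) (const 0)) (fun _ _ => .inCase) h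
    · exact (HasType.caseOf ht (.const 0) (.const 0)).sn ⟨h.fixFree, trivial, trivial⟩

end DiffCalc

theorem mainTheorem1 {C : Type*} [Zero C] (Γ : List DiffCalc.Ty) (t : DiffCalc.Term C)
    (T : DiffCalc.Ty) (ht : DiffCalc.HasType Γ t T) (hfix : t.FixFree) :
    DiffCalc.Red T Γ t ∧ DiffCalc.SN t :=
  ⟨DiffCalc.red_iff.mpr ⟨ht, ht.sn hfix⟩, ht.sn hfix⟩
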